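/- **Setting.** Let $\Omega\subseteq\mathbb R^n$ be open, $1\le p\le\infty$, let $A:L^p(\Omega)\to L^p(\Omega)$ be a bounded linear operator, $u_0\in L^p(\Omega)$, and let $\alpha\in L^\infty(\Omega)$ satisfy $\alpha(x)\in[\alpha_0,1]$ for a.e. $x\in\Omega$, for some $\alpha_0\in(0,1)$. Let $T>0$. **Fractional integral.** A curve $f\in C([0,T];L^p(\Omega))$ is identified with a jointly measurable function $f(t,x)$ which, for every $t\in[0,T]$, represents the class $f(t)$. For measurable $\beta:\Omega\to[0,1]$ put $$J_t^{\beta(x)}f(t,x)=\frac1{\Gamma(\beta(x))}\int_0^t(t-s)^{\beta(x)-1}f(s,x)\,ds\ \text{ if }\beta(x)\in(0,1],\qquad J_t^{\beta(x)}f(t,x)=f(t,x)\ \text{ if }\beta(x)=0,$$ whenever the integral exists as a Lebesgue integral (up to a null set of points $x$ this does not depend on the representative). **Caputo derivative.** We say that $cD_t^{\alpha(x)}f=g$ on $[0,T]$, for $f\in C([0,T];L^p(\Omega))$ and $g:[0,T]\to L^p(\Omega)$, if for every $t\in[0,T]$ the function $h(t):=J_t^{1-\alpha(x)}\big[f(t,x)-f(0,x)\big]$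 exists for a.e. $x\in\Omega$ and belongs to $L^p(\Omega)$, and the curve $h:[0,T]\to L^p(\Omega)$ is differentiable in the norm of $L^p(\Omega)$ at every $t\in[0,T]$ (one-sidedly at the end points) with $h'(t)=g(t)$. **Solution.** A function $\varphi\in C([0,T];L^p(\Omega))$ is a solution on $[0,T]\times\Omega$ of $$cD_t^{\alpha(x)}u(t,x)=Au(t,x),\qquad u(0,x)=u_0(x),$$ if $cD_t^{\alpha(x)}\varphi=A\varphi$ on $[0,T]$ and $\varphi(0,x)=u_0(x)$ for a.e. $x\in\Omega$. **Proposition.** Let $\varphi\in C([0,T];L^p(\Omega))$. Then $\varphi$ is a solution of this problem on $[0,T]\times\Omega$ if and only if, for every $t\in[0,T]$ and a.e. $x\in\Omega$, the integral below exists and $$\varphi(t,x)=u_0(x)+\frac1{\Gamma(\alpha(x))}\int_0^t(t-s)^{\alpha(x)-1}A\varphi(s,x)\,ds .$$ -/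

import Mathlib

open MeasureTheory Set
open scoped ENNReal

noncomputable section

namespace VariableOrder

/-- Existence of the Riemann-Liouville integral of (constant) order `β ∈ [0, 1]` of a real function
`f` at time `t`: for order `0` there is nothing to ask, for positive order the integrand has to be
Lebesgue integrable. -/
def RLIntegrableAt (β : ℝ) (f : ℝ → ℝ) (t : ℝ) : Prop :=
  β ≠ 0 → IntervalIntegrable (fun s => (t - s) ^ (β - 1) * f s) volume 0 t

/-- The Riemann-Liouville integral of (constant) order `β ∈ [0, 1]` of a real function `f` at
time `t`; the order `0` gives `f t`. -/
def rlIntegral (β : ℝ) (f : ℝ → ℝ) (t : ℝ) : ℝ :=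
  if β = 0 then f t
  else 1 / Real.Gamma β * ∫ s in (0 : ℝ)..t, (t - s) ^ (β - 1) * f s

variable {X : Type*} [MeasurableSpace X] {μ : Measure X} {p : ℝ≥0∞}

/-- A curve `f` in `L^p(μ)`, regarded on `[0, T]`, is represented by the jointly measurable real
function `F (t, x)`: for every `t ∈ [0, T]`, the class `f t` is the class of `F t`. For a sigma-finite
measure, two such `F` agree, for almost every `x`, at almost every `t ∈ [0, T]`; so integrals
over time of `F (s, x)` do not depend on the choice, up to a null set of points `x`. -/
def IsJointVersion (T : ℝ) (f : ℝ → Lp ℝ p μ) (F : ℝ → X → ℝ) : Prop :=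
  Measurable (Function.uncurry F) ∧ ∀ t ∈ Icc 0 T, F t =ᵐ[μ] f t

/-- `g = J_t^{β(x)} f` on `[0, T]`, as curves in `L^p(μ)`: for every `t ∈ [0, T]` and almost every `x`
the Riemann-Liouville integral of order `β x` of `f (·, x)` exists at `t` and equals `g (t, x)`. -/
def IsRLIntegral (T : ℝ) (β : X → ℝ) (f g : ℝ → Lp ℝ p μ) : Prop :=
  ∃ F : ℝ → X → ℝ, IsJointVersion T f F ∧ ∀ t ∈ Icc 0 T, ∀ᵐ x ∂μ,
    RLIntegrableAt (β x) (fun s => F s x) t ∧ g t x = rlIntegral (β x) (fun s => F s x) t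

variable [Fact (1 ≤ p)]

/-- `g = D_t^{α(x)} f` on `[0, T]` (Riemann-Liouville derivative): `J_t^{1 - α(x)} f` exists as a curve
in `L^p(μ)` and has derivative `g t` in the norm of `L^p(μ)` at every `t ∈ [0, T]` (one-sided at the
end points). -/
def IsRLDeriv (T : ℝ) (α : X → ℝ) (f g : ℝ → Lp ℝ p μ) : Prop :=
  ∃ h : ℝ → Lp ℝ p μ, IsRLIntegral T (fun x => 1 - α x) f h ∧
    ∀ t ∈ Icc 0 T, HasDerivWithinAt h (g t) (Icc 0 T) t

/-- `g = cD_t^{α(x)} f` on `[0, T]` (Caputo derivative): the Riemann-Liouville derivative of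
`f (t, x) - f (0, x)`. -/
def IsCaputoDeriv (T : ℝ) (α : X → ℝ) (f g : ℝ → Lp ℝ p μ) : Prop :=
  IsRLDeriv T α (fun t => f t - f 0) g

/-- `φ` solves `cD_t^{α(x)} φ = A φ` on `[0, T]` with `φ(0) = u₀`. -/
structure IsSolution (T : ℝ) (α : X → ℝ) (A : Lp ℝ p μ →L[ℝ] Lp ℝ p μ) (u₀ : Lp ℝ p μ)
    (φ : ℝ → Lp ℝ p μ) : Prop where
  caputo : IsCaputoDeriv T α φ (fun t => A (φ t))
  initial : φ 0 = u₀

/-- `φ(t,x) = u₀(x) + (1/Γ(α(x))) ∫₀ᵗ (t-s)^{α(x)-1} Aφ(s,x) ds`, with an integral that exists, for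
every `t ∈ [0, T]` and almost every `x`. -/
def SatisfiesIntegralEq (T : ℝ) (α : X → ℝ) (A : Lp ℝ p μ →L[ℝ] Lp ℝ p μ) (u₀ : Lp ℝ p μ)
    (φ : ℝ → Lp ℝ p μ) : Prop :=
  ∃ F : ℝ → X → ℝ, IsJointVersion T (fun t => A (φ t)) F ∧ ∀ t ∈ Icc 0 T, ∀ᵐ x ∂μ,
    IntervalIntegrable (fun s => (t - s) ^ (α x - 1) * F s x) volume 0 t ∧
    φ t x = u₀ x + 1 / Real.Gamma (α x) * ∫ s in (0 : ℝ)..t, (t - s) ^ (α x - 1) * F s x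

end VariableOrder

end

namespace VariableOrder

open Filter Topology

/-! Put `w = φ - φ 0` and `g = A φ`, both continuous curves in `L^p`. The claim is that `J^{1-α} w`
is differentiable with derivative `g` exactly when `w = J^α g`. For a fixed point `x` this is Abel's
inversion: by Fubini and the Beta integral, `J^a J^b` with `a + b = 1` is the ordinary integral
(`rlIntegral_rlIntegral`). If `J^{1-α} w = ∫ g`, applying `J^α` gives `∫ w = ∫ J^α g`, hence `w =
J^α g` at almost every time; conversely `J^{1-α} J^α g = ∫ g`.

The rest links this scalar fact to `L^p`. The Bochner primitive of `g` is computed pointwise in `x`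
(`IsJointVersion.coeFn_integral`). Statements for every `t` and almost every `x` become statements
for almost every `x` and almost every `t` by Fubini for null sets, which is why joint measurability
of `J^{β(x)} F` is needed. The inversion thus yields `w t = J^α g t` only for almost every `t`. To
reach every `t`, both sides are integrated over a set of finite measure: the results are continuous
in `t`, because `α ≥ α₀ > 0` gives the Abel kernels a common integrable majorant in time
(`IsJointVersion.ae_eq_rlIntegral_of_ae`). -/

/-! ### Abel integrals of scalar functions -/

theorem integral_rpow_mul_rpow {a b r t : ℝ} (ha : 0 < a) (hb : 0 < b) (hab : a + b = 1)
    (hrt : r < t) :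
    ∫ s in r..t, (t - s) ^ (a - 1) * (s - r) ^ (b - 1) = Real.Gamma a * Real.Gamma b := by
  have h0 : 0 < t - r := sub_pos.2 hrt
  have key := Complex.betaIntegral_scaled (b : ℂ) (a : ℂ) h0
  have hG := Complex.Gamma_mul_Gamma_eq_betaIntegral (s := (b : ℂ)) (t := (a : ℂ))
    (by simpa using hb) (by simpa using ha)
  have hba : (b : ℂ) + a = 1 := by rw [← Complex.ofReal_add, add_comm, hab]; simp
  rw [hba, Complex.Gamma_one, one_mul] at hG
  rw [hba, sub_self, Complex.cpow_zero, one_mul, ← hG] at key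
  have hshift : ∫ s in r..t, (t - s) ^ (a - 1) * (s - r) ^ (b - 1)
      = ∫ x in (0 : ℝ)..(t - r), x ^ (b - 1) * ((t - r) - x) ^ (a - 1) := by
    have := intervalIntegral.integral_comp_sub_right (a := r) (b := t)
      (fun x => x ^ (b - 1) * ((t - r) - x) ^ (a - 1)) r
    rw [sub_self] at this
    rw [← this]
    refine intervalIntegral.integral_congr fun s _ => ?_
    simp only [sub_sub_sub_cancel_right]
    ring
  rw [hshift]
  apply Complex.ofReal_injective
  rw [← intervalIntegral.integral_ofReal, Complex.ofReal_mul, ← Complex.Gamma_ofReal,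
    ← Complex.Gamma_ofReal, mul_comm (Complex.Gamma a), ← key]
  refine intervalIntegral.integral_congr fun x hx => ?_
  rw [uIcc_of_le h0.le] at hx
  simp only [Complex.ofReal_mul]
  rw [Complex.ofReal_cpow hx.1, Complex.ofReal_cpow (by linarith [hx.2])]
  push_cast
  ring

/-- A non-integrable function has integral `0` by convention, whereas this integral is `Γ(a) Γ(b) >
0`. -/
theorem intervalIntegrable_rpow_mul_rpow {a b r t : ℝ} (ha : 0 < a) (hb : 0 < b)
    (hab : a + b = 1) (hrt : r < t) :
    IntervalIntegrable (fun s => (t - s) ^ (a - 1) * (s - r) ^ (b - 1)) volume r t := by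
  by_contra h
  have := integral_rpow_mul_rpow ha hb hab hrt
  rw [intervalIntegral.integral_undef h] at this
  exact (mul_pos (Real.Gamma_pos_of_pos ha) (Real.Gamma_pos_of_pos hb)).ne this

/-- The kernel of the iterated Abel integral on the square `(0, t]²`. -/
noncomputable def abelKernel (a b t : ℝ) (s r : ℝ) : ℝ :=
  (Iio s).indicator (fun r => (t - s) ^ (a - 1) * (s - r) ^ (b - 1)) r

theorem measurable_abelKernel (a b t : ℝ) : Measurable (Function.uncurry (abelKernel a b t)) := by
  have : Function.uncurry (abelKernel a b t) = {z : ℝ × ℝ | z.2 < z.1}.indicator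
      (fun z => (t - z.1) ^ (a - 1) * (z.1 - z.2) ^ (b - 1)) := by
    ext z
    simp [Function.uncurry, abelKernel, indicator]
  rw [this]
  exact Measurable.indicator (by fun_prop) (measurableSet_lt measurable_snd measurable_fst)

theorem abelKernel_nonneg {a b t s : ℝ} (hs : s ≤ t) (r : ℝ) : 0 ≤ abelKernel a b t s r := by
  refine indicator_nonneg (fun r hr => ?_) r
  exact mul_nonneg (Real.rpow_nonneg (sub_nonneg.2 hs) _)
    (Real.rpow_nonneg (sub_nonneg.2 (le_of_lt hr)) _)

theorem abelKernel_eq_indicator (a b t r : ℝ) :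
    (fun s => abelKernel a b t s r)
      = (Ioi r).indicator (fun s => (t - s) ^ (a - 1) * (s - r) ^ (b - 1)) := by
  ext s
  simp [abelKernel, indicator]

theorem integrableOn_abelKernel {a b t r : ℝ} (ha : 0 < a) (hb : 0 < b) (hab : a + b = 1)
    (hr : r ∈ Ioo 0 t) : IntegrableOn (fun s => abelKernel a b t s r) (Ioc 0 t) := by
  rw [abelKernel_eq_indicator, integrableOn_indicator_iff measurableSet_Ioi, inter_comm,
    Ioc_inter_Ioi, sup_eq_right.2 hr.1.le]
  exact (intervalIntegrable_iff_integrableOn_Ioc_of_le hr.2.le).1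
    (intervalIntegrable_rpow_mul_rpow ha hb hab hr.2)

theorem setIntegral_abelKernel {a b t r : ℝ} (ha : 0 < a) (hb : 0 < b) (hab : a + b = 1)
    (hr : r ∈ Ioo 0 t) :
    ∫ s in Ioc 0 t, abelKernel a b t s r = Real.Gamma a * Real.Gamma b := by
  rw [abelKernel_eq_indicator, setIntegral_indicator measurableSet_Ioi,
    Ioc_inter_Ioi, sup_eq_right.2 hr.1.le, ← intervalIntegral.integral_of_le hr.2.le,
    integral_rpow_mul_rpow ha hb hab hr.2]

/-- Tonelli, integrating in `s` first: the kernel contributes the constant `Γ(a) Γ(b)`, whatever `r`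
is, so integrability of `f` suffices. -/
theorem integrable_abelKernel_mul {a b t : ℝ} (ha : 0 < a) (hb : 0 < b) (hab : a + b = 1)
    {f : ℝ → ℝ} (hf : IntegrableOn f (Ioc 0 t)) :
    Integrable (Function.uncurry fun s r => abelKernel a b t s r * f r)
      ((volume.restrict (Ioc 0 t)).prod (volume.restrict (Ioc 0 t))) := by
  -- The end point `r = t` is excluded: there the kernel vanishes on `(0, t]` and its integral is
  -- `0`, not `Γ(a) Γ(b)`.
  have hmem : ∀ᵐ r ∂volume.restrict (Ioc 0 t), r ∈ Ioo 0 t := by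
    rw [← restrict_Ioo_eq_restrict_Ioc]
    exact ae_restrict_mem measurableSet_Ioo
  have hmeas : AEStronglyMeasurable (Function.uncurry fun s r => abelKernel a b t s r * f r)
      ((volume.restrict (Ioc 0 t)).prod (volume.restrict (Ioc 0 t))) :=
    (measurable_abelKernel a b t).aestronglyMeasurable.mul hf.1.comp_snd
  refine (integrable_prod_iff' hmeas).2 ⟨?_, ?_⟩
  · filter_upwards [hmem] with r hr
    exact Integrable.mul_const (integrableOn_abelKernel ha hb hab hr) (f r)
  · refine (hf.norm.const_mul (Real.Gamma a * Real.Gamma b)).congr ?_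
    filter_upwards [hmem] with r hr
    rw [← setIntegral_abelKernel ha hb hab hr, ← integral_mul_const]
    refine setIntegral_congr_fun measurableSet_Ioc fun s hs => ?_
    simp only [Function.uncurry, norm_mul, Real.norm_of_nonneg (abelKernel_nonneg hs.2 r)]

theorem setIntegral_abelKernel_mul {a b t s : ℝ} (hs : s ∈ Ioc 0 t) (f : ℝ → ℝ) :
    ∫ r in Ioc 0 t, abelKernel a b t s r * f r
      = (t - s) ^ (a - 1) * ∫ r in (0 : ℝ)..s, (s - r) ^ (b - 1) * f r := by
  rw [intervalIntegral.integral_of_le hs.1.le, integral_Ioc_eq_integral_Ioo (y := s),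
    ← integral_const_mul]
  have : (fun r => abelKernel a b t s r * f r)
      = (Iio s).indicator fun r => (t - s) ^ (a - 1) * ((s - r) ^ (b - 1) * f r) := by
    ext r
    by_cases h : r < s <;> simp [abelKernel, indicator, h, mul_assoc]
  have hset : Ioc 0 t ∩ Iio s = Ioo 0 s := by
    ext r
    exact ⟨fun h => ⟨h.1.1, h.2⟩, fun h => ⟨⟨h.1, h.2.le.trans hs.2⟩, h.2⟩⟩
  rw [this, setIntegral_indicator measurableSet_Iio, hset]

theorem integrableOn_rpow_mul_abel {a b t : ℝ} (ha : 0 < a) (hb : 0 < b) (hab : a + b = 1)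
    {f : ℝ → ℝ} (hf : IntegrableOn f (Ioc 0 t)) :
    IntegrableOn (fun s => (t - s) ^ (a - 1) * ∫ r in (0 : ℝ)..s, (s - r) ^ (b - 1) * f r)
      (Ioc 0 t) := by
  refine (integrable_abelKernel_mul ha hb hab hf).integral_prod_left.congr ?_
  filter_upwards [ae_restrict_mem measurableSet_Ioc] with s hs
  exact setIntegral_abelKernel_mul hs f

theorem integral_rpow_mul_abel {a b t : ℝ} (ha : 0 < a) (hb : 0 < b) (hab : a + b = 1)
    (ht : 0 ≤ t) {f : ℝ → ℝ} (hf : IntegrableOn f (Ioc 0 t)) :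
    ∫ s in (0 : ℝ)..t, (t - s) ^ (a - 1) * ∫ r in (0 : ℝ)..s, (s - r) ^ (b - 1) * f r
      = Real.Gamma a * Real.Gamma b * ∫ r in (0 : ℝ)..t, f r := by
  rw [intervalIntegral.integral_of_le ht, intervalIntegral.integral_of_le ht]
  have h1 : ∫ s in Ioc 0 t, (t - s) ^ (a - 1) * ∫ r in (0 : ℝ)..s, (s - r) ^ (b - 1) * f r
      = ∫ s in Ioc 0 t, ∫ r in Ioc 0 t, abelKernel a b t s r * f r :=
    setIntegral_congr_fun measurableSet_Ioc fun s hs => (setIntegral_abelKernel_mul hs f).symm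
  rw [h1, integral_integral_swap (integrable_abelKernel_mul ha hb hab hf), ← integral_const_mul,
    integral_Ioc_eq_integral_Ioo, integral_Ioc_eq_integral_Ioo]
  refine setIntegral_congr_fun measurableSet_Ioo fun r hr => ?_
  rw [integral_mul_const, setIntegral_abelKernel ha hb hab hr]

theorem rlIntegral_of_ne_zero {b : ℝ} (hb : b ≠ 0) (f : ℝ → ℝ) (t : ℝ) :
    rlIntegral b f t = 1 / Real.Gamma b * ∫ s in (0 : ℝ)..t, (t - s) ^ (b - 1) * f s :=
  if_neg hb

/-- Abel integrals of complementary orders compose to the ordinary integral. -/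
theorem rlIntegral_rlIntegral {a b t : ℝ} (ha : 0 < a) (hb : 0 < b) (hab : a + b = 1)
    (ht : 0 ≤ t) {f : ℝ → ℝ} (hf : IntegrableOn f (Ioc 0 t)) :
    rlIntegral a (rlIntegral b f) t = ∫ r in (0 : ℝ)..t, f r := by
  have h := integral_rpow_mul_abel ha hb hab ht hf
  have ha' := (Real.Gamma_pos_of_pos ha).ne'
  have hb' := (Real.Gamma_pos_of_pos hb).ne'
  have hpull : ∫ s in (0 : ℝ)..t, (t - s) ^ (a - 1) * rlIntegral b f s
      = 1 / Real.Gamma b *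
        ∫ s in (0 : ℝ)..t, (t - s) ^ (a - 1) * ∫ r in (0 : ℝ)..s, (s - r) ^ (b - 1) * f r := by
    rw [← intervalIntegral.integral_const_mul]
    refine intervalIntegral.integral_congr fun s _ => ?_
    simp only [rlIntegral_of_ne_zero hb.ne']
    ring
  rw [rlIntegral_of_ne_zero ha.ne', hpull, h]
  field_simp

theorem rlIntegrableAt_rlIntegral {a b t : ℝ} (ha : 0 < a) (hb : 0 < b) (hab : a + b = 1)
    (ht : 0 ≤ t) {f : ℝ → ℝ} (hf : IntegrableOn f (Ioc 0 t)) :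
    RLIntegrableAt a (rlIntegral b f) t := by
  intro _
  rw [intervalIntegrable_iff_integrableOn_Ioc_of_le ht]
  refine ((integrableOn_rpow_mul_abel ha hb hab hf).const_mul (1 / Real.Gamma b)).congr ?_
  refine Filter.Eventually.of_forall fun s => ?_
  simp only [rlIntegral_of_ne_zero hb.ne']
  ring

/-- The Abel integral is already integrable against `(t - s) ^ (-b)`; the bounded factor `(t - s) ^
b` removes this weight. -/
theorem integrableOn_rlIntegral {b t : ℝ} (hb : b ∈ Ioo 0 1) (ht : 0 ≤ t) {f : ℝ → ℝ}
    (hf : IntegrableOn f (Ioc 0 t)) : IntegrableOn (rlIntegral b f) (Ioc 0 t) := by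
  have ha : 0 < 1 - b := sub_pos.2 hb.2
  have h := rlIntegrableAt_rlIntegral ha hb.1 (by ring) ht hf ha.ne'
  rw [intervalIntegrable_iff_integrableOn_Ioc_of_le ht] at h
  have h2 : IntegrableOn (fun s => (t - s) ^ b * ((t - s) ^ (1 - b - 1) * rlIntegral b f s))
      (Ioc 0 t) := by
    refine Integrable.bdd_mul (c := t ^ b) h (by fun_prop (disch := exact hb.1.le)) ?_
    filter_upwards [ae_restrict_mem measurableSet_Ioc] with s hs
    rw [Real.norm_of_nonneg (Real.rpow_nonneg (by linarith [hs.2]) _)]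
    exact Real.rpow_le_rpow (by linarith [hs.2]) (by linarith [hs.1]) hb.1.le
  -- At `s = t` the two powers do not cancel to `1`, so the end point is dropped.
  rw [integrableOn_Ioc_iff_integrableOn_Ioo] at h2 ⊢
  refine h2.congr_fun (fun s hs => ?_) measurableSet_Ioo
  have hs' : 0 < t - s := sub_pos.2 hs.2
  simp only
  rw [← mul_assoc, ← Real.rpow_add hs']
  simp

theorem rlIntegral_congr_ae {b t : ℝ} (hb : b ≠ 0) (ht : 0 ≤ t) {f g : ℝ → ℝ}
    (h : f =ᵐ[volume.restrict (Ioc 0 t)] g) : rlIntegral b f t = rlIntegral b g t := by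
  rw [rlIntegral_of_ne_zero hb, rlIntegral_of_ne_zero hb, intervalIntegral.integral_of_le ht,
    intervalIntegral.integral_of_le ht]
  congr 1
  refine integral_congr_ae ?_
  filter_upwards [h] with s hs
  rw [hs]

theorem RLIntegrableAt.congr_ae {b t : ℝ} (ht : 0 ≤ t) {f g : ℝ → ℝ}
    (hf : RLIntegrableAt b f t) (h : f =ᵐ[volume.restrict (Ioc 0 t)] g) :
    RLIntegrableAt b g t := by
  intro hb
  have := hf hb
  rw [intervalIntegrable_iff_integrableOn_Ioc_of_le ht] at this ⊢
  refine this.congr ?_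
  filter_upwards [h] with s hs
  rw [hs]

theorem rlIntegral_one (f : ℝ → ℝ) (t : ℝ) : rlIntegral 1 f t = ∫ s in (0 : ℝ)..t, f s := by
  simp [rlIntegral]

theorem ae_restrict_Ioc_mono {s t : ℝ} (hst : s ≤ t) {P : ℝ → Prop}
    (h : ∀ᵐ r ∂volume.restrict (Ioc 0 t), P r) : ∀ᵐ r ∂volume.restrict (Ioc 0 s), P r :=
  ae_mono (Measure.restrict_mono (Ioc_subset_Ioc_right hst) le_rfl) h

/-- Lebesgue differentiation of the two equal primitives. -/
theorem ae_eq_of_forall_integral_eq {T : ℝ} {f g : ℝ → ℝ} (hf : IntegrableOn f (Ioc 0 T))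
    (hg : IntegrableOn g (Ioc 0 T))
    (h : ∀ t ∈ Icc 0 T, ∫ s in (0 : ℝ)..t, f s = ∫ s in (0 : ℝ)..t, g s) :
    f =ᵐ[volume.restrict (Ioc 0 T)] g := by
  rcases lt_or_ge T 0 with hT | hT
  · simp [Ioc_eq_empty_of_le hT.le, Filter.EventuallyEq]
  have hf' := ((intervalIntegrable_iff_integrableOn_Ioc_of_le hT).2 hf).ae_hasDerivAt_integral
  have hg' := ((intervalIntegrable_iff_integrableOn_Ioc_of_le hT).2 hg).ae_hasDerivAt_integral
  rw [uIcc_of_le hT] at hf' hg'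
  rw [Filter.EventuallyEq, ← restrict_Ioo_eq_restrict_Ioc, ae_restrict_iff' measurableSet_Ioo]
  filter_upwards [hf', hg'] with t htf htg ht
  have h1 := htf (Ioo_subset_Icc_self ht) 0 (left_mem_Icc.2 hT)
  have h2 := htg (Ioo_subset_Icc_self ht) 0 (left_mem_Icc.2 hT)
  refine h1.unique (h2.congr_of_eventuallyEq ?_)
  filter_upwards [Ioo_mem_nhds ht.1 ht.2] with s hs using h s (Ioo_subset_Icc_self hs)

/-- If the Abel integral of order `1 - b` of `f` is the primitive of `g`, then `f` is the Abel
integral of order `b` of `g`. -/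
theorem ae_eq_rlIntegral_of_rlIntegral_ae_eq {b T : ℝ} (hb : b ∈ Ioc 0 1) {f g : ℝ → ℝ}
    (hf : IntegrableOn f (Ioc 0 T)) (hg : IntegrableOn g (Ioc 0 T))
    (h : ∀ᵐ t ∂volume.restrict (Ioc 0 T), rlIntegral (1 - b) f t = ∫ s in (0 : ℝ)..t, g s) :
    ∀ᵐ t ∂volume.restrict (Ioc 0 T), f t = rlIntegral b g t := by
  rcases hb.2.eq_or_lt with rfl | hb1
  · filter_upwards [h] with t ht
    rw [rlIntegral_one, ← ht]
    simp [rlIntegral]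
  rcases lt_or_ge T 0 with hT | hT
  · simp [Ioc_eq_empty_of_le hT.le]
  have ha : 0 < 1 - b := sub_pos.2 hb1
  have hgb := integrableOn_rlIntegral ⟨hb.1, hb1⟩ hT hg
  refine ae_eq_of_forall_integral_eq hf hgb fun t ht => ?_
  have mono : ∀ {u : ℝ → ℝ}, IntegrableOn u (Ioc 0 T) → ∀ {s : ℝ}, s ≤ T →
      IntegrableOn u (Ioc 0 s) := fun hu _ hs => hu.mono_set (Ioc_subset_Ioc_right hs)
  -- Both primitives are written as `J^b J^{1-b}`, of `f` and of `J^b g`; it remains to compare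
  -- `J^{1-b} f` with `J^{1-b} J^b g = ∫ g`.
  rw [← rlIntegral_rlIntegral hb.1 ha (by ring) ht.1 (mono hf ht.2),
    ← rlIntegral_rlIntegral hb.1 ha (by ring) ht.1 (mono hgb ht.2)]
  refine rlIntegral_congr_ae hb.1.ne' ht.1 (ae_restrict_Ioc_mono ht.2 ?_)
  filter_upwards [h, ae_restrict_mem measurableSet_Ioc] with s hs hs'
  rw [hs, rlIntegral_rlIntegral ha hb.1 (by ring) hs'.1.le (mono hg hs'.2)]

/-- If `f` is the Abel integral of order `b` of `g`, almost everywhere and at `t`, then the Abel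
integral of order `1 - b` of `f` is the primitive of `g` at `t`. -/
theorem rlIntegral_eq_of_ae_eq_rlIntegral {b t : ℝ} (hb : b ∈ Ioc 0 1) (ht : 0 ≤ t) {f g : ℝ → ℝ}
    (hg : IntegrableOn g (Ioc 0 t)) (hft : f t = rlIntegral b g t)
    (h : ∀ᵐ s ∂volume.restrict (Ioc 0 t), f s = rlIntegral b g s) :
    RLIntegrableAt (1 - b) f t ∧ rlIntegral (1 - b) f t = ∫ s in (0 : ℝ)..t, g s := by
  rcases hb.2.eq_or_lt with rfl | hb1
  · refine ⟨fun h => absurd (sub_self _) h, ?_⟩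
    rw [← rlIntegral_one, ← hft]
    simp [rlIntegral]
  have ha : 0 < 1 - b := sub_pos.2 hb1
  have h' : rlIntegral b g =ᵐ[volume.restrict (Ioc 0 t)] f := by
    filter_upwards [h] with s hs using hs.symm
  exact ⟨(rlIntegrableAt_rlIntegral ha hb.1 (by ring) ht hg).congr_ae ht h',
    by rw [← rlIntegral_congr_ae ha.ne' ht h', rlIntegral_rlIntegral ha hb.1 (by ring) ht hg]⟩

/-! ### Joint measurability and integrals over sets of finite measure -/

section

theorem measurable_indicator_Gamma : Measurable ((Ioi (0 : ℝ)).indicator Real.Gamma) := by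
  have h : ContinuousOn Real.Gamma (Ioi 0) := fun x hx =>
    (Real.differentiableAt_Gamma fun m =>
      ((neg_nonpos.mpr m.cast_nonneg).trans_lt hx).ne').continuousAt.continuousWithinAt
  rw [← piecewise_eq_indicator]
  exact h.measurable_piecewise continuousOn_const measurableSet_Ioi

variable {X : Type*} [MeasurableSpace X] {μ : Measure X} {p : ℝ≥0∞}

/-- Makes the exceptional sets measurable in `(t, x)`, so that "almost every `t`" and "almost every
`x`" can be exchanged. -/
theorem measurable_rlIntegral {β : X → ℝ} (hβ : Measurable β) (hβ0 : ∀ x, 0 ≤ β x)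
    {F : ℝ → X → ℝ} (hF : Measurable (Function.uncurry F)) :
    Measurable fun z : ℝ × X => rlIntegral (β z.2) (fun s => F s z.2) z.1 := by
  have hker : Measurable fun w : (ℝ × X) × ℝ =>
      (w.1.1 - w.2) ^ (β w.1.2 - 1) * F w.2 w.1.2 := by
    have hF' : Measurable fun w : (ℝ × X) × ℝ => F w.2 w.1.2 :=
      hF.comp (measurable_snd.prodMk (measurable_snd.comp measurable_fst))
    exact Measurable.mul (by fun_prop) hF'
  have hint : Measurable fun z : ℝ × X =>
      ∫ s in (0 : ℝ)..z.1, (z.1 - s) ^ (β z.2 - 1) * F s z.2 := by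
    -- The limits of integration depend on `z`; indicators of two measurable sets, one for each
    -- orientation of the interval, turn them into integrals over the whole line.
    have key : ∀ B : Set ((ℝ × X) × ℝ), MeasurableSet B → Measurable fun z : ℝ × X =>
        ∫ s, B.indicator (fun w => (w.1.1 - w.2) ^ (β w.1.2 - 1) * F w.2 w.1.2) (z, s) :=
      fun B hB => (StronglyMeasurable.integral_prod_right
        (f := fun z s => B.indicator
          (fun w => (w.1.1 - w.2) ^ (β w.1.2 - 1) * F w.2 w.1.2) (z, s))
        (hker.indicator hB).stronglyMeasurable).measurable
    have hB1 : MeasurableSet {w : (ℝ × X) × ℝ | 0 < w.2 ∧ w.2 ≤ w.1.1} :=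
      (measurableSet_lt measurable_const measurable_snd).inter
        (measurableSet_le measurable_snd (measurable_fst.comp measurable_fst))
    have hB2 : MeasurableSet {w : (ℝ × X) × ℝ | w.1.1 < w.2 ∧ w.2 ≤ 0} :=
      (measurableSet_lt (measurable_fst.comp measurable_fst) measurable_snd).inter
        (measurableSet_le measurable_snd measurable_const)
    convert (key _ hB1).sub (key _ hB2) using 1
    ext z
    simp only [Pi.sub_apply]
    rw [intervalIntegral, ← integral_indicator measurableSet_Ioc,
      ← integral_indicator measurableSet_Ioc]
    rfl
  have heq : (fun z : ℝ × X => rlIntegral (β z.2) (fun s => F s z.2) z.1)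
      = fun z => if β z.2 = 0 then F z.1 z.2 else
        1 / (Ioi (0 : ℝ)).indicator Real.Gamma (β z.2) *
          ∫ s in (0 : ℝ)..z.1, (z.1 - s) ^ (β z.2 - 1) * F s z.2 := by
    ext z
    by_cases h : β z.2 = 0
    · simp [rlIntegral, h]
    · have : β z.2 ∈ Ioi (0 : ℝ) := lt_of_le_of_ne (hβ0 _) (Ne.symm h)
      simp only [rlIntegral, if_neg h, indicator_of_mem this]
  rw [heq]
  have hβ' : Measurable fun z : ℝ × X => β z.2 := hβ.comp measurable_snd
  exact Measurable.ite (hβ' (measurableSet_singleton 0)) hF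
    ((measurable_const.div (measurable_indicator_Gamma.comp hβ')).mul hint)

theorem IsJointVersion.mono {T T' : ℝ} {f : ℝ → Lp ℝ p μ} {F : ℝ → X → ℝ}
    (hF : IsJointVersion T f F) (h : T' ≤ T) : IsJointVersion T' f F :=
  ⟨hF.1, fun t ht => hF.2 t ⟨ht.1, ht.2.trans h⟩⟩

theorem IsJointVersion.reverse {T : ℝ} {f : ℝ → Lp ℝ p μ} {F : ℝ → X → ℝ}
    (hF : IsJointVersion T f F) : IsJointVersion T (fun s => f (T - s)) fun s => F (T - s) :=
  ⟨hF.1.comp ((measurable_const.sub measurable_fst).prodMk measurable_snd),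
    fun _ ht => hF.2 _ ⟨sub_nonneg.2 ht.2, sub_le_self _ ht.1⟩⟩

variable [Fact (1 ≤ p)]

theorem integrableOn_Lp (u : Lp ℝ p μ) {S : Set X} (hS : μ S < ∞) : IntegrableOn u S μ := by
  have : IsFiniteMeasure (μ.restrict S) := isFiniteMeasure_restrict.2 hS.ne
  exact ((Lp.memLp u).restrict S).integrable Fact.out

/-- Hölder's inequality on `S`, with `C` a power of `μ S`. -/
theorem exists_setIntegral_norm_le {S : Set X} (hS : μ S < ∞) :
    ∃ C : ℝ, 0 ≤ C ∧ ∀ u : Lp ℝ p μ, ∫ x in S, ‖u x‖ ∂μ ≤ C * ‖u‖ := by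
  -- For `p = ∞` the conventions `toReal ∞ = 0` and `1 / 0 = 0` give the correct exponent `1`.
  have hexp : 0 ≤ 1 / (1 : ℝ≥0∞).toReal - 1 / p.toReal := by
    have hp : 1 ≤ p := Fact.out
    rcases eq_or_ne p ∞ with rfl | hp'
    · simp
    · have : 1 ≤ p.toReal := by simpa using ENNReal.toReal_mono hp' hp
      simpa using inv_le_one_of_one_le₀ this
  have hfin : μ S ^ (1 / (1 : ℝ≥0∞).toReal - 1 / p.toReal) ≠ ∞ :=
    ENNReal.rpow_ne_top_of_nonneg hexp hS.ne
  refine ⟨(μ S ^ (1 / (1 : ℝ≥0∞).toReal - 1 / p.toReal)).toReal, ENNReal.toReal_nonneg,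
    fun u => ?_⟩
  have hmeas : AEStronglyMeasurable u (μ.restrict S) := (Lp.aestronglyMeasurable u).restrict
  rw [integral_norm_eq_lintegral_enorm hmeas, ← eLpNorm_one_eq_lintegral_enorm, mul_comm,
    Lp.norm_def, ← ENNReal.toReal_mul]
  refine ENNReal.toReal_mono (ENNReal.mul_ne_top (Lp.eLpNorm_ne_top u) hfin) ?_
  refine (eLpNorm_le_eLpNorm_mul_rpow_measure_univ (Fact.out : 1 ≤ p) hmeas).trans ?_
  rw [Measure.restrict_apply_univ]
  exact mul_le_mul' (eLpNorm_mono_measure u Measure.restrict_le_self) le_rfl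

/-- Multiplying a bounded curve in `L^p` by a kernel dominated by an integrable function of time
gives a jointly integrable function on sets of finite measure. -/
theorem IsJointVersion.integrable_mul [SFinite μ] {T M : ℝ} {g : ℝ → Lp ℝ p μ} {F : ℝ → X → ℝ}
    (hF : IsJointVersion T g F) (hM : ∀ t ∈ Icc 0 T, ‖g t‖ ≤ M) {S : Set X} (hS : μ S < ∞)
    {k : ℝ × X → ℝ} (hk : Measurable k) {κ : ℝ → ℝ} (hκ : IntegrableOn κ (Ioc 0 T))
    (hkκ : ∀ s ∈ Ioc 0 T, ∀ x, ‖k (s, x)‖ ≤ κ s) :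
    Integrable (fun z : ℝ × X => k z * F z.1 z.2)
      ((volume.restrict (Ioc 0 T)).prod (μ.restrict S)) := by
  obtain ⟨C, hC0, hC⟩ := exists_setIntegral_norm_le (p := p) hS
  have hmeas : Measurable (fun z : ℝ × X => k z * F z.1 z.2) := hk.mul hF.1
  have hsec : ∀ s ∈ Ioc 0 T, Integrable (F s) (μ.restrict S) := fun s hs =>
    (integrableOn_Lp (g s) hS).congr
      (ae_restrict_of_ae (hF.2 s (Ioc_subset_Icc_self hs)).symm)
  have hbd : ∀ s ∈ Ioc 0 T, ∀ x, ‖k (s, x) * F s x‖ ≤ κ s * ‖F s x‖ := fun s hs x => by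
    rw [norm_mul]
    exact mul_le_mul_of_nonneg_right (hkκ s hs x) (norm_nonneg _)
  have hint : ∀ s ∈ Ioc 0 T, Integrable (fun x => k (s, x) * F s x) (μ.restrict S) :=
    fun s hs => ((hsec s hs).norm.const_mul (κ s)).mono'
      (hmeas.comp measurable_prodMk_left).aestronglyMeasurable
      (Eventually.of_forall (hbd s hs))
  refine (integrable_prod_iff hmeas.aestronglyMeasurable).2 ⟨?_, ?_⟩
  · filter_upwards [ae_restrict_mem measurableSet_Ioc] with s hs using hint s hs
  · refine Integrable.mono' ((hκ.norm.mul_const (C * M)))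
      (hmeas.norm.stronglyMeasurable.integral_prod_right).aestronglyMeasurable ?_
    filter_upwards [ae_restrict_mem measurableSet_Ioc] with s hs
    rw [Real.norm_of_nonneg (integral_nonneg fun x => norm_nonneg _)]
    calc ∫ x in S, ‖k (s, x) * F s x‖ ∂μ ≤ ∫ x in S, κ s * ‖F s x‖ ∂μ :=
          integral_mono (hint s hs).norm ((hsec s hs).norm.const_mul _) (hbd s hs)
      _ = κ s * ∫ x in S, ‖g s x‖ ∂μ := by
          rw [integral_const_mul]
          congr 1
          refine integral_congr_ae ?_
          filter_upwards [ae_restrict_of_ae (hF.2 s (Ioc_subset_Icc_self hs))] with x hx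
          rw [hx]
      _ ≤ ‖κ s‖ * (C * M) := by
          refine mul_le_mul (le_abs_self _) ((hC _).trans ?_)
            (integral_nonneg fun x => norm_nonneg _) (norm_nonneg _)
          exact mul_le_mul_of_nonneg_left (hM s (Ioc_subset_Icc_self hs)) hC0

theorem IsJointVersion.ae_integrableOn_mul [SigmaFinite μ] {T M : ℝ} {g : ℝ → Lp ℝ p μ}
    {F : ℝ → X → ℝ} (hF : IsJointVersion T g F) (hM : ∀ t ∈ Icc 0 T, ‖g t‖ ≤ M)
    {k : ℝ × X → ℝ} (hk : Measurable k) {κ : ℝ → ℝ} (hκ : IntegrableOn κ (Ioc 0 T))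
    (hkκ : ∀ s ∈ Ioc 0 T, ∀ x, ‖k (s, x)‖ ≤ κ s) :
    ∀ᵐ x ∂μ, IntegrableOn (fun s => k (s, x) * F s x) (Ioc 0 T) :=
  ae_of_forall_measure_lt_top_ae_restrict _ fun _ _ hS =>
    (hF.integrable_mul hM hS hk hκ hkκ).prod_left_ae

theorem IsJointVersion.ae_integrableOn [SigmaFinite μ] {T M : ℝ} {g : ℝ → Lp ℝ p μ}
    {F : ℝ → X → ℝ} (hF : IsJointVersion T g F) (hM : ∀ t ∈ Icc 0 T, ‖g t‖ ≤ M) :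
    ∀ᵐ x ∂μ, IntegrableOn (fun s => F s x) (Ioc 0 T) := by
  simpa using hF.ae_integrableOn_mul hM (k := fun _ => 1) measurable_const
    (κ := fun _ => 1) (by simp) (by simp)

/-- Integration over a set of finite measure against bounded weights, as a family of continuous
functionals on `L^p` with uniformly controlled norms. -/
theorem exists_setIntegralCLM (p : ℝ≥0∞) [Fact (1 ≤ p)] {S : Set X} (hS : μ S < ∞) :
    ∃ C : ℝ, 0 ≤ C ∧ ∀ (w : X → ℝ) (c : ℝ), Measurable w → 0 ≤ c → (∀ x, ‖w x‖ ≤ c) →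
      ∃ L : Lp ℝ p μ →L[ℝ] ℝ, ‖L‖ ≤ c * C ∧ ∀ u, L u = ∫ x in S, w x * u x ∂μ := by
  obtain ⟨C, hC0, hC⟩ := exists_setIntegral_norm_le (μ := μ) (p := p) hS
  refine ⟨C, hC0, fun w c hw hc hwc => ?_⟩
  have hint : ∀ u : Lp ℝ p μ, IntegrableOn (fun x => w x * u x) S μ := fun u =>
    (integrableOn_Lp u hS).bdd_mul hw.aestronglyMeasurable (Eventually.of_forall hwc)
  let l : Lp ℝ p μ →ₗ[ℝ] ℝ :=
    { toFun := fun u => ∫ x in S, w x * u x ∂μ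
      map_add' := fun u v => by
        rw [← integral_add (hint u) (hint v)]
        refine integral_congr_ae ?_
        filter_upwards [ae_restrict_of_ae (Lp.coeFn_add u v)] with x hx
        rw [hx, Pi.add_apply, mul_add]
      map_smul' := fun a u => by
        rw [RingHom.id_apply, smul_eq_mul, ← integral_const_mul]
        refine integral_congr_ae ?_
        filter_upwards [ae_restrict_of_ae (Lp.coeFn_smul a u)] with x hx
        rw [hx, Pi.smul_apply, smul_eq_mul, mul_left_comm] }
  have hl : ∀ u, ‖l u‖ ≤ c * C * ‖u‖ := fun u => calc
    ‖l u‖ ≤ ∫ x in S, ‖w x * u x‖ ∂μ := norm_integral_le_integral_norm _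
    _ ≤ ∫ x in S, c * ‖u x‖ ∂μ :=
        integral_mono (hint u).norm ((integrableOn_Lp u hS).norm.const_mul c) fun x => by
          rw [norm_mul]
          exact mul_le_mul_of_nonneg_right (hwc x) (norm_nonneg _)
    _ ≤ c * C * ‖u‖ := by
        rw [integral_const_mul, mul_assoc]
        exact mul_le_mul_of_nonneg_left (hC u) hc
  exact ⟨l.mkContinuous _ hl, l.mkContinuous_norm_le (mul_nonneg hc hC0) hl, fun u => rfl⟩

theorem exists_clm_eq_setIntegral (p : ℝ≥0∞) [Fact (1 ≤ p)] {S : Set X} (hS : μ S < ∞) :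
    ∃ L : Lp ℝ p μ →L[ℝ] ℝ, ∀ u, L u = ∫ x in S, u x ∂μ := by
  obtain ⟨C, -, hC⟩ := exists_setIntegralCLM (μ := μ) p hS
  obtain ⟨L, -, hL⟩ := hC (fun _ => 1) 1 measurable_const zero_le_one (by simp)
  exact ⟨L, by simpa using hL⟩

theorem exists_norm_le_of_continuousOn {T : ℝ} {g : ℝ → Lp ℝ p μ}
    (hg : ContinuousOn g (Icc 0 T)) : ∃ M, 0 ≤ M ∧ ∀ t ∈ Icc 0 T, ‖g t‖ ≤ M := by
  obtain ⟨M, hM⟩ := isCompact_Icc.exists_bound_of_continuousOn hg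
  exact ⟨max M 0, le_max_right _ _, fun t ht => (hM t ht).trans (le_max_left _ _)⟩

/-- The Bochner integral of a continuous curve in `L^p` is computed pointwise. -/
theorem IsJointVersion.coeFn_integral [SigmaFinite μ] {T : ℝ} {g : ℝ → Lp ℝ p μ} {F : ℝ → X → ℝ}
    (hF : IsJointVersion T g F) (hg : ContinuousOn g (Icc 0 T)) (hT : 0 ≤ T) :
    ∀ᵐ x ∂μ, (∫ s in (0 : ℝ)..T, g s : Lp ℝ p μ) x = ∫ s in (0 : ℝ)..T, F s x := by
  obtain ⟨M, -, hM⟩ := exists_norm_le_of_continuousOn hg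
  have hgi : IntervalIntegrable g volume 0 T := hg.intervalIntegrable_of_Icc hT
  have hprod : ∀ S, μ S < ∞ → Integrable (fun z : ℝ × X => F z.1 z.2)
      ((volume.restrict (Ioc 0 T)).prod (μ.restrict S)) := fun S hS => by
    simpa using hF.integrable_mul hM hS (k := fun _ => 1) measurable_const
      (κ := fun _ => 1) (by simp) (by simp)
  simp only [intervalIntegral.integral_of_le hT] at hgi ⊢
  -- Both sides are tested on sets of finite measure. Integration over `S` is a continuous
  -- functional, so it passes through the Bochner integral; Fubini does the same on the other side.
  refine ae_eq_of_forall_setIntegral_eq_of_sigmaFinite (fun S _ hS => integrableOn_Lp _ hS)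
    (fun S _ hS => (hprod S hS).integral_prod_right) fun S _ hS => ?_
  obtain ⟨L, hL⟩ := exists_clm_eq_setIntegral (μ := μ) p hS
  rw [← hL, ← L.integral_comp_comm hgi.1,
    ← integral_integral_swap (hprod S hS)]
  refine setIntegral_congr_fun measurableSet_Ioc fun s hs => ?_
  rw [hL]
  exact integral_congr_ae (ae_restrict_of_ae (hF.2 s (Ioc_subset_Icc_self hs)).symm)

end

/-! ### Variable-order Abel integrals: domination and continuity in time -/

section

variable {X : Type*}

theorem rpow_sub_one_le {a₀ a s T : ℝ} (ha : a ∈ Icc a₀ 1) (ha₀ : 0 < a₀) (hs : s ∈ Ioc 0 T) :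
    s ^ (a - 1) ≤ max 1 T * s ^ (a₀ - 1) := by
  have h : s ^ (a - a₀) ≤ max 1 T := by
    rcases le_total s 1 with h1 | h1
    · exact (Real.rpow_le_one hs.1.le h1 (sub_nonneg.2 ha.1)).trans (le_max_left _ _)
    · calc s ^ (a - a₀) ≤ s ^ (1 : ℝ) :=
            Real.rpow_le_rpow_of_exponent_le h1 (by linarith [ha.2])
        _ ≤ max 1 T := by rw [Real.rpow_one]; exact hs.2.trans (le_max_right _ _)
  calc s ^ (a - 1) = s ^ (a - a₀) * s ^ (a₀ - 1) := by
        rw [← Real.rpow_add hs.1]; congr 1; ring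
    _ ≤ _ := mul_le_mul_of_nonneg_right h (Real.rpow_nonneg hs.1.le _)

theorem exists_one_div_Gamma_le {a₀ : ℝ} (ha₀ : 0 < a₀) :
    ∃ D : ℝ, ∀ a ∈ Icc a₀ 1, ‖1 / Real.Gamma a‖ ≤ D := by
  refine isCompact_Icc.exists_bound_of_continuousOn fun a ha => ?_
  have ha' : 0 < a := ha₀.trans_le ha.1
  exact (continuousAt_const.div (Real.differentiableAt_Gamma fun m =>
    ((neg_nonpos.mpr m.cast_nonneg).trans_lt ha').ne').continuousAt
    (Real.Gamma_pos_of_pos ha').ne').continuousWithinAt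

/-- The normalised Abel kernel of variable order. -/
noncomputable def rlKernel (α : X → ℝ) (z : ℝ × X) : ℝ :=
  1 / Real.Gamma (α z.2) * z.1 ^ (α z.2 - 1)

/-- The lower bound `a₀ > 0` makes the majorant, a multiple of `s ^ (a₀ - 1)`, integrable at `0` and
independent of `x`; `1 / Γ` is bounded on `[a₀, 1]` by compactness. -/
theorem exists_rlKernel_le {α : X → ℝ} {a₀ : ℝ} (ha₀ : 0 < a₀) (hα : ∀ x, α x ∈ Icc a₀ 1)
    (T : ℝ) : ∃ κ : ℝ → ℝ, IntegrableOn κ (Ioc 0 T) ∧ ∀ s ∈ Ioc 0 T, 0 ≤ κ s ∧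
      ∀ x, ‖rlKernel α (s, x)‖ ≤ κ s := by
  obtain ⟨D, hD⟩ := exists_one_div_Gamma_le ha₀
  rcases le_or_gt T 0 with hT | hT
  · exact ⟨0, by simp [Ioc_eq_empty_of_le hT], by simp [Ioc_eq_empty_of_le hT]⟩
  have hnn : 0 ≤ max 1 T := zero_le_one.trans (le_max_left _ _)
  refine ⟨fun s => max 1 T * s ^ (a₀ - 1) * max D 0, ?_, fun s hs => ⟨?_, fun x => ?_⟩⟩
  · refine Integrable.mul_const (Integrable.const_mul ?_ _) _
    exact (intervalIntegrable_iff_integrableOn_Ioc_of_le hT.le).1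
      (intervalIntegral.intervalIntegrable_rpow' (by linarith))
  · exact mul_nonneg (mul_nonneg hnn (Real.rpow_nonneg hs.1.le _)) (le_max_right _ _)
  · rw [rlKernel, norm_mul, mul_comm, Real.norm_of_nonneg (Real.rpow_nonneg hs.1.le _)]
    exact mul_le_mul (rpow_sub_one_le (hα x) ha₀ hs) ((hD _ (hα x)).trans (le_max_left _ _))
      (norm_nonneg _) (mul_nonneg hnn (Real.rpow_nonneg hs.1.le _))

/-- After `s ↦ t - s` the singular kernel no longer depends on `t`; only the function is shifted. -/
theorem rlIntegral_eq_setIntegral_rlKernel {α : X → ℝ} {x : X} (hα : 0 < α x) (f : ℝ → ℝ) {t : ℝ}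
    (ht : 0 ≤ t) :
    rlIntegral (α x) f t = ∫ s in Ioc 0 t, rlKernel α (s, x) * f (t - s) := by
  have h := intervalIntegral.integral_comp_sub_left (a := 0) (b := t)
    (fun s => (t - s) ^ (α x - 1) * f s) t
  simp only [sub_sub_cancel, sub_self, sub_zero] at h
  rw [rlIntegral_of_ne_zero hα.ne', ← h, intervalIntegral.integral_of_le ht,
    ← integral_const_mul]
  simp only [rlKernel, mul_assoc]

theorem norm_reverse_le {E : Type*} [Norm E] {g : ℝ → E} {M t T : ℝ}
    (hM : ∀ t ∈ Icc 0 T, ‖g t‖ ≤ M) (ht : t ∈ Icc 0 T) : ∀ s ∈ Icc 0 t, ‖g (t - s)‖ ≤ M :=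
  fun _ hs => hM _ ⟨sub_nonneg.2 hs.2, (sub_le_self _ hs.1).trans ht.2⟩

variable [MeasurableSpace X] {μ : Measure X} {p : ℝ≥0∞} [Fact (1 ≤ p)]

theorem measurable_rlKernel {α : X → ℝ} (hα : Measurable α) (hα0 : ∀ x, 0 < α x) :
    Measurable (rlKernel α) := by
  have h : (fun z : ℝ × X => Real.Gamma (α z.2))
      = fun z => (Ioi (0 : ℝ)).indicator Real.Gamma (α z.2) := by
    ext z
    exact (indicator_of_mem (mem_Ioi.2 (hα0 _)) _).symm
  have hΓ : Measurable fun z : ℝ × X => Real.Gamma (α z.2) := by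
    rw [h]
    exact measurable_indicator_Gamma.comp (hα.comp measurable_snd)
  exact (measurable_const.div hΓ).mul (by fun_prop)

variable {T a₀ : ℝ} {α : X → ℝ} {g : ℝ → Lp ℝ p μ} {G : ℝ → X → ℝ}

theorem IsJointVersion.ae_intervalIntegrable_rpow [SigmaFinite μ] (hG : IsJointVersion T g G)
    (hg : ContinuousOn g (Icc 0 T)) (ha₀ : 0 < a₀) (hαm : Measurable α)
    (hα : ∀ x, α x ∈ Icc a₀ 1) {t : ℝ} (ht : t ∈ Icc 0 T) :
    ∀ᵐ x ∂μ, IntervalIntegrable (fun s => (t - s) ^ (α x - 1) * G s x) volume 0 t := by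
  obtain ⟨M, -, hM⟩ := exists_norm_le_of_continuousOn hg
  obtain ⟨κ, hκ, hκ'⟩ := exists_rlKernel_le ha₀ hα t
  have hα0 : ∀ x, 0 < α x := fun x => ha₀.trans_le (hα x).1
  filter_upwards [(hG.mono ht.2).reverse.ae_integrableOn_mul (norm_reverse_le hM ht)
    (measurable_rlKernel hαm hα0) hκ fun s hs => (hκ' s hs).2] with x hx
  rw [← intervalIntegrable_iff_integrableOn_Ioc_of_le ht.1] at hx
  have h2 := (hx.const_mul (Real.Gamma (α x))).comp_sub_left t
  simp only [sub_zero, sub_self, sub_sub_cancel] at h2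
  refine h2.symm.congr ?_
  intro s _
  have := (Real.Gamma_pos_of_pos (hα0 x)).ne'
  simp only [rlKernel]
  field_simp

theorem IsJointVersion.integrable_rlKernel_mul [SFinite μ] (hG : IsJointVersion T g G)
    (hg : ContinuousOn g (Icc 0 T)) (ha₀ : 0 < a₀) (hαm : Measurable α)
    (hα : ∀ x, α x ∈ Icc a₀ 1) {S : Set X} (hS : μ S < ∞) {t : ℝ} (ht : t ∈ Icc 0 T) :
    Integrable (fun z : ℝ × X => rlKernel α z * G (t - z.1) z.2)
      ((volume.restrict (Ioc 0 t)).prod (μ.restrict S)) := by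
  obtain ⟨M, -, hM⟩ := exists_norm_le_of_continuousOn hg
  obtain ⟨κ, hκ, hκ'⟩ := exists_rlKernel_le ha₀ hα t
  exact (hG.mono ht.2).reverse.integrable_mul (norm_reverse_le hM ht) hS
    (measurable_rlKernel hαm fun x => ha₀.trans_le (hα x).1) hκ fun s hs => (hκ' s hs).2

/-- By Fubini this is `∫₀ᵗ L s (g (t - s)) ds` with functionals satisfying `‖L s‖ ≤ κ s * C`.
Continuity of `g` and dominated convergence conclude. -/
theorem IsJointVersion.continuousOn_setIntegral_rlIntegral [SFinite μ]
    (hG : IsJointVersion T g G) (hg : ContinuousOn g (Icc 0 T)) (ha₀ : 0 < a₀)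
    (hαm : Measurable α) (hα : ∀ x, α x ∈ Icc a₀ 1) {S : Set X} (hS : μ S < ∞) :
    ContinuousOn (fun t => ∫ x in S, rlIntegral (α x) (fun s => G s x) t ∂μ) (Icc 0 T) := by
  obtain ⟨M, hM0, hM⟩ := exists_norm_le_of_continuousOn hg
  obtain ⟨κ, hκ, hκ'⟩ := exists_rlKernel_le ha₀ hα T
  obtain ⟨C, hC0, hC⟩ := exists_setIntegralCLM (μ := μ) p hS
  have hα0 : ∀ x, 0 < α x := fun x => ha₀.trans_le (hα x).1
  have hkm := measurable_rlKernel hαm hα0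
  have hL : ∀ s : ℝ, ∃ L : Lp ℝ p μ →L[ℝ] ℝ, s ∈ Ioc 0 T →
      ‖L‖ ≤ κ s * C ∧ ∀ u, L u = ∫ x in S, rlKernel α (s, x) * u x ∂μ := fun s => by
    by_cases hs : s ∈ Ioc 0 T
    · obtain ⟨L, h⟩ := hC (fun x => rlKernel α (s, x)) (κ s) (hkm.comp measurable_prodMk_left)
        (hκ' s hs).1 (hκ' s hs).2
      exact ⟨L, fun _ => h⟩
    · exact ⟨0, fun h => absurd h hs⟩
  choose L hL using hL
  let lam : ℝ → ℝ → ℝ := fun t s => ∫ x in S, rlKernel α (s, x) * G (t - s) x ∂μ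
  have hlam : ∀ t ∈ Icc 0 T, ∀ s ∈ Ioc 0 t, lam t s = L s (g (t - s)) := fun t ht s hs => by
    rw [(hL s ⟨hs.1, hs.2.trans ht.2⟩).2]
    refine integral_congr_ae ?_
    filter_upwards [ae_restrict_of_ae (hG.2 (t - s)
      ⟨sub_nonneg.2 hs.2, (sub_le_self _ hs.1.le).trans ht.2⟩)] with x hx
    rw [hx]
  -- The moving upper limit becomes an indicator on the fixed interval `(0, T]`. It is discontinuous
  -- in `t` only where `s = t`, a null set of `s`.
  have heq : ∀ t ∈ Icc 0 T, ∫ x in S, rlIntegral (α x) (fun s => G s x) t ∂μ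
      = ∫ s in Ioc 0 T, (Iic t).indicator (lam t) s := fun t ht => by
    simp_rw [rlIntegral_eq_setIntegral_rlKernel (hα0 _) _ ht.1]
    rw [← integral_integral_swap (hG.integrable_rlKernel_mul hg ha₀ hαm hα hS ht),
      setIntegral_indicator measurableSet_Iic, Ioc_inter_Iic, inf_eq_right.2 ht.2]
  refine ContinuousOn.congr (fun t ht => ?_) heq
  refine continuousWithinAt_of_dominated (bound := fun s => κ s * C * M) ?_ ?_
    ((hκ.mul_const C).mul_const M) ?_
  · refine Eventually.of_forall fun t' => ?_
    have hm : Measurable fun z : ℝ × X => rlKernel α z * G (t' - z.1) z.2 :=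
      hkm.mul (hG.1.comp ((measurable_const.sub measurable_fst).prodMk measurable_snd))
    exact (hm.stronglyMeasurable.integral_prod_right.measurable.indicator
      measurableSet_Iic).aestronglyMeasurable
  · filter_upwards [self_mem_nhdsWithin] with t' ht'
    filter_upwards [ae_restrict_mem measurableSet_Ioc] with s hs
    by_cases hst : s ≤ t'
    · rw [indicator_of_mem (mem_Iic.2 hst), hlam t' ht' s ⟨hs.1, hst⟩]
      exact ((L s).le_opNorm _).trans (mul_le_mul (hL s hs).1
        (norm_reverse_le hM ht' s ⟨hs.1.le, hst⟩) (norm_nonneg _)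
        (mul_nonneg (hκ' s hs).1 hC0))
    · rw [indicator_of_notMem (by simpa using hst), norm_zero]
      exact mul_nonneg (mul_nonneg (hκ' s hs).1 hC0) hM0
  · have hne : ∀ᵐ s ∂volume.restrict (Ioc 0 T), s ≠ t :=
      ae_restrict_of_ae (by simp [ae_iff, measure_singleton])
    filter_upwards [ae_restrict_mem measurableSet_Ioc, hne] with s hs hst
    rcases lt_or_gt_of_ne hst with hlt | hgt
    · have hev : ∀ᶠ t' in 𝓝[Icc 0 T] t, t' ∈ Icc 0 T ∧ s < t' :=
        (eventually_mem_nhdsWithin).and (nhdsWithin_le_nhds (lt_mem_nhds hlt))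
      have hcont : ContinuousWithinAt (fun t' => L s (g (t' - s))) (Icc 0 T) t := by
        refine (L s).continuous.continuousAt.comp_continuousWithinAt ?_
        have hgc : Tendsto g (𝓝[Icc 0 T] (t - s)) (𝓝 (g (t - s))) :=
          hg (t - s) ⟨sub_nonneg.2 hlt.le, (sub_le_self _ hs.1.le).trans ht.2⟩
        refine hgc.comp (tendsto_nhdsWithin_iff.2 ⟨?_, ?_⟩)
        · exact tendsto_nhdsWithin_of_tendsto_nhds (Continuous.tendsto (by fun_prop) t)
        · filter_upwards [hev] with t' ht'
          exact ⟨sub_nonneg.2 ht'.2.le, (sub_le_self _ hs.1.le).trans ht'.1.2⟩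
      refine hcont.congr_of_eventuallyEq ?_ ?_
      · filter_upwards [hev] with t' ht'
        rw [indicator_of_mem (mem_Iic.2 ht'.2.le), hlam t' ht'.1 s ⟨hs.1, ht'.2.le⟩]
      · rw [indicator_of_mem (mem_Iic.2 hlt.le), hlam t ht s ⟨hs.1, hlt.le⟩]
    · refine (continuousWithinAt_const (b := (0 : ℝ))).congr_of_eventuallyEq ?_ ?_
      · filter_upwards [nhdsWithin_le_nhds (gt_mem_nhds hgt)] with t' ht'
        rw [indicator_of_notMem (by simpa using ht')]
      · rw [indicator_of_notMem (by simpa using hgt)]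

/-- A continuous curve in `L^p` that agrees at almost every time with the Abel integral of a
continuous curve agrees with it at every time. -/
theorem IsJointVersion.ae_eq_rlIntegral_of_ae [SigmaFinite μ] (hG : IsJointVersion T g G)
    (hg : ContinuousOn g (Icc 0 T)) (ha₀ : 0 < a₀) (hαm : Measurable α)
    (hα : ∀ x, α x ∈ Icc a₀ 1) (hT : 0 < T) {w : ℝ → Lp ℝ p μ} (hw : ContinuousOn w (Icc 0 T))
    (h : ∀ᵐ t ∂volume.restrict (Icc 0 T), ∀ᵐ x ∂μ,
      w t x = rlIntegral (α x) (fun s => G s x) t) :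
    ∀ t ∈ Icc 0 T, ∀ᵐ x ∂μ, w t x = rlIntegral (α x) (fun s => G s x) t := by
  intro t ht
  have hα0 : ∀ x, 0 < α x := fun x => ha₀.trans_le (hα x).1
  refine ae_eq_of_forall_setIntegral_eq_of_sigmaFinite (fun S _ hS => integrableOn_Lp _ hS)
    (fun S _ hS => ?_) fun S _ hS => ?_
  · simp_rw [rlIntegral_eq_setIntegral_rlKernel (hα0 _) _ ht.1]
    exact (hG.integrable_rlKernel_mul hg ha₀ hαm hα hS ht).integral_prod_right
  · obtain ⟨L, hL⟩ := exists_clm_eq_setIntegral (μ := μ) p hS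
    refine Measure.eqOn_Icc_of_ae_eq (μ := volume) hT.ne
      (f := fun t => ∫ x in S, w t x ∂μ) ?_ ?_
      (hG.continuousOn_setIntegral_rlIntegral hg ha₀ hαm hα hS) ht
    · filter_upwards [h] with s hs
      exact integral_congr_ae (ae_restrict_of_ae hs)
    · simp_rw [← hL]
      exact L.continuous.comp_continuousOn hw

end

/-! ### Existence of joint versions; primitives of continuous curves -/

section

variable {X : Type*} [MeasurableSpace X] {μ : Measure X} {p : ℝ≥0∞}

/-- A curve that is piecewise constant in time has a jointly measurable version. -/
theorem measurable_floor_version (g : ℝ → Lp ℝ p μ) (δ : ℝ) :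
    Measurable fun z : ℝ × X => (g (δ * ⌊z.1 / δ⌋) : X → ℝ) z.2 := by
  have h : Measurable fun y : ℤ × X => (g (δ * y.1) : X → ℝ) y.2 :=
    measurable_from_prod_countable_right fun k => (Lp.stronglyMeasurable (g (δ * k))).measurable
  exact h.comp (((measurable_fst.div_const δ).floor).prodMk measurable_snd)

variable [Fact (1 ≤ p)]

/-- Uniform continuity gives step approximations converging at the rate `2⁻ⁿ` at every time.
Summability of the rate forces convergence for almost every `x`. -/
theorem exists_isJointVersion {T : ℝ} {g : ℝ → Lp ℝ p μ} (hg : ContinuousOn g (Icc 0 T)) :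
    ∃ G : ℝ → X → ℝ, IsJointVersion T g G := by
  have huc := isCompact_Icc.uniformContinuousOn_of_continuous hg
  rw [Metric.uniformContinuousOn_iff] at huc
  choose δ hδ hgδ using fun n : ℕ => huc ((1 / 2) ^ n) (by positivity)
  let τ : ℕ → ℝ → ℝ := fun n t => δ n / 2 * ⌊t / (δ n / 2)⌋
  have hτ : ∀ n, ∀ t ∈ Icc 0 T, dist (g (τ n t)) (g t) < (1 / 2) ^ n := fun n t ht => by
    have hpos : 0 < δ n / 2 := half_pos (hδ n)
    have h1 : τ n t ≤ t := by
      have := mul_le_mul_of_nonneg_left (Int.floor_le (t / (δ n / 2))) hpos.le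
      rwa [mul_div_cancel₀ _ hpos.ne'] at this
    have h2 : 0 ≤ τ n t :=
      mul_nonneg hpos.le (Int.cast_nonneg (Int.floor_nonneg.2 (div_nonneg ht.1 hpos.le)))
    have h3 : t < τ n t + δ n / 2 := by
      have := mul_lt_mul_of_pos_left (Int.lt_floor_add_one (t / (δ n / 2))) hpos
      rw [mul_div_cancel₀ _ hpos.ne', mul_add, mul_one] at this
      exact this
    refine hgδ n _ ⟨h2, h1.trans ht.2⟩ _ ht ?_
    rw [Real.dist_eq, abs_sub_lt_iff]
    exact ⟨by linarith [hδ n], by linarith [hδ n]⟩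
  -- The `limsup` is jointly measurable without discussing where the sequence converges.
  refine ⟨fun t x => limsup (fun n => (g (τ n t) : X → ℝ) x) atTop,
    Measurable.limsup fun n => measurable_floor_version g (δ n / 2), fun t ht => ?_⟩
  have hlim : Tendsto (fun n => g (τ n t)) atTop (𝓝 (g t)) := by
    rw [tendsto_iff_dist_tendsto_zero]
    exact squeeze_zero (fun _ => dist_nonneg) (fun n => (hτ n t ht).le)
      (tendsto_pow_atTop_nhds_zero_of_lt_one (by norm_num) (by norm_num))
  have hcau : ∀ᵐ x ∂μ, ∃ l : ℝ, Tendsto (fun n => (g (τ n t) : X → ℝ) x) atTop (𝓝 l) := by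
    refine Lp.ae_tendsto_of_cauchy_eLpNorm (p := p)
      (fun n => Lp.aestronglyMeasurable (g (τ n t))) Fact.out
      (B := fun n => ENNReal.ofReal (2 * (1 / 2) ^ n)) ?_ fun N n m hn hm => ?_
    · rw [← ENNReal.ofReal_tsum_of_nonneg (fun n => by positivity)
        (summable_geometric_two.mul_left 2)]
      exact ENNReal.ofReal_ne_top
    · rw [← Lp.edist_def, edist_dist]
      refine (ENNReal.ofReal_lt_ofReal_iff (by positivity)).2 ?_
      have hpow : ∀ k, N ≤ k → ((1 : ℝ) / 2) ^ k ≤ (1 / 2) ^ N := fun k hk =>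
        pow_le_pow_of_le_one (by norm_num) (by norm_num) hk
      calc dist (g (τ n t)) (g (τ m t)) ≤ dist (g (τ n t)) (g t) + dist (g (τ m t)) (g t) :=
            dist_triangle_right _ _ _
        _ < 2 * (1 / 2) ^ N := by
            linarith [hτ n t ht, hτ m t ht, hpow n hn, hpow m hm]
  -- The almost everywhere limit is identified with `g t` along a subsequence, obtained from
  -- convergence in measure.
  obtain ⟨ns, hns, hsub⟩ := (tendstoInMeasure_of_tendsto_Lp hlim).exists_seq_tendsto_ae
  filter_upwards [hcau, hsub] with x ⟨l, hl⟩ hx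
  rw [hl.limsup_eq]
  exact tendsto_nhds_unique (hl.comp hns.tendsto_atTop) hx

theorem ae_ae_restrict_of_forall_ae [SFinite μ] {T : ℝ} {P : ℝ → X → Prop}
    (hP : MeasurableSet {z : ℝ × X | P z.1 z.2}) (h : ∀ t ∈ Icc 0 T, ∀ᵐ x ∂μ, P t x) :
    ∀ᵐ x ∂μ, ∀ᵐ t ∂volume.restrict (Ioc 0 T), P t x := by
  rw [← Measure.ae_ae_comm hP]
  filter_upwards [ae_restrict_mem measurableSet_Ioc] with t ht using h t (Ioc_subset_Icc_self ht)

theorem hasDerivWithinAt_integral {E : Type*} [NormedAddCommGroup E] [NormedSpace ℝ E]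
    [CompleteSpace E] {T : ℝ} {g : ℝ → E} (hg : ContinuousOn g (Icc 0 T)) {t : ℝ}
    (ht : t ∈ Icc 0 T) :
    HasDerivWithinAt (fun t => ∫ s in (0 : ℝ)..t, g s) (g t) (Icc 0 T) t := by
  have : Fact (t ∈ Icc 0 T) := ⟨ht⟩
  exact intervalIntegral.integral_hasDerivWithinAt_right
    ((hg.mono (Icc_subset_Icc_right ht.2)).intervalIntegrable_of_Icc ht.1)
    (hg.stronglyMeasurableAtFilter_nhdsWithin measurableSet_Icc t) (hg t ht)

theorem eq_integral_of_hasDerivWithinAt {E : Type*} [NormedAddCommGroup E] [NormedSpace ℝ E]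
    [CompleteSpace E] {T : ℝ} {h g : ℝ → E} (hg : ContinuousOn g (Icc 0 T)) (h0 : h 0 = 0)
    (hd : ∀ t ∈ Icc 0 T, HasDerivWithinAt h (g t) (Icc 0 T) t) {t : ℝ} (ht : t ∈ Icc 0 T) :
    h t = ∫ s in (0 : ℝ)..t, g s := by
  have hsub : Icc 0 t ⊆ Icc 0 T := Icc_subset_Icc_right ht.2
  rw [intervalIntegral.integral_eq_sub_of_hasDeriv_right_of_le ht.1
    (fun s hs => ((hd s (hsub hs)).continuousWithinAt).mono hsub) (fun s hs => ?_)
    ((hg.mono hsub).intervalIntegrable_of_Icc ht.1), h0, sub_zero]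
  refine (hd s (hsub (Ioo_subset_Icc_self hs))).mono_of_mem_nhdsWithin ?_
  exact mem_nhdsWithin_of_mem_nhds (Icc_mem_nhds hs.1 (hs.2.trans_le ht.2))

theorem rlIntegral_zero_time {β : ℝ} (hβ : β ≠ 0) (f : ℝ → ℝ) : rlIntegral β f 0 = 0 := by
  simp [rlIntegral_of_ne_zero hβ]

/-! ### The equivalence for a measurable order -/

section

variable [SigmaFinite μ] {T a₀ : ℝ} {α : X → ℝ} {w g : ℝ → Lp ℝ p μ}

/-- If the Riemann-Liouville derivative of order `α x` of a continuous curve vanishing at time `0`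
is `g`, then the curve is the Riemann-Liouville integral of `g`. -/
theorem IsRLDeriv.ae_eq_rlIntegral (hT : 0 < T) (ha₀ : 0 < a₀) (hαm : Measurable α)
    (hα : ∀ x, α x ∈ Icc a₀ 1) (hw : ContinuousOn w (Icc 0 T)) (hw0 : w 0 = 0)
    (hg : ContinuousOn g (Icc 0 T)) (h : IsRLDeriv T α w g) {G : ℝ → X → ℝ}
    (hG : IsJointVersion T g G) :
    ∀ t ∈ Icc 0 T, ∀ᵐ x ∂μ, w t x = rlIntegral (α x) (fun s => G s x) t := by
  obtain ⟨v, ⟨W, hW, hWv⟩, hv⟩ := h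
  have h0 : (0 : ℝ) ∈ Icc 0 T := left_mem_Icc.2 hT.le
  -- Where `α x < 1` the integral runs over a trivial interval; where `α x = 1` the order is `0`,
  -- and the value is that of `w 0 = 0`.
  have hv0 : v 0 = 0 := by
    refine Lp.ext ?_
    filter_upwards [hWv 0 h0, hW.2 0 h0, Lp.coeFn_zero ℝ p μ] with x hx hx0 hz
    rw [hx.2, hz]
    by_cases hβ : 1 - α x = 0
    · rw [rlIntegral, if_pos hβ, hx0, hw0, hz]
    · exact rlIntegral_zero_time hβ _
  obtain ⟨M, -, hM⟩ := exists_norm_le_of_continuousOn hg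
  obtain ⟨N, -, hN⟩ := exists_norm_le_of_continuousOn hw
  have hprim : ∀ t ∈ Icc 0 T, ∀ᵐ x ∂μ,
      rlIntegral (1 - α x) (fun s => W s x) t = rlIntegral 1 (fun s => G s x) t := fun t ht => by
    filter_upwards [hWv t ht, (hG.mono ht.2).coeFn_integral
      (hg.mono (Icc_subset_Icc_right ht.2)) ht.1] with x hx hx'
    rw [← hx.2, eq_integral_of_hasDerivWithinAt hg hv0 hv ht, hx', rlIntegral_one]
  have hmeas : MeasurableSet {z : ℝ × X | rlIntegral (1 - α z.2) (fun s => W s z.2) z.1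
      = rlIntegral 1 (fun s => G s z.2) z.1} :=
    measurableSet_eq_fun
      (measurable_rlIntegral (measurable_const.sub hαm) (fun x => sub_nonneg.2 (hα x).2) hW.1)
      (measurable_rlIntegral measurable_const (fun _ => zero_le_one) hG.1)
  have hae : ∀ᵐ x ∂μ, ∀ᵐ t ∂volume.restrict (Ioc 0 T),
      W t x = rlIntegral (α x) (fun s => G s x) t := by
    filter_upwards [ae_ae_restrict_of_forall_ae hmeas hprim, hW.ae_integrableOn hN,
      hG.ae_integrableOn hM] with x hx hWx hGx
    refine ae_eq_rlIntegral_of_rlIntegral_ae_eq (f := fun s => W s x)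
      ⟨ha₀.trans_le (hα x).1, (hα x).2⟩ hWx hGx ?_
    simpa only [rlIntegral_one] using hx
  have hmeas' : MeasurableSet {z : X × ℝ | W z.2 z.1 = rlIntegral (α z.1) (fun s => G s z.1) z.2} :=
    measurable_swap (measurableSet_eq_fun hW.1
      (measurable_rlIntegral hαm (fun x => ha₀.le.trans (hα x).1) hG.1))
  rw [Measure.ae_ae_comm hmeas', restrict_Ioc_eq_restrict_Icc] at hae
  refine hG.ae_eq_rlIntegral_of_ae hg ha₀ hαm hα hT hw ?_
  filter_upwards [hae, ae_restrict_mem measurableSet_Icc] with t ht htI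
  filter_upwards [ht, hW.2 t htI] with x hx hx'
  rw [← hx', hx]

/-- The required curve `J^{1-α} w` is the Bochner primitive of `g`. Equality at the given `t`,
besides almost every time, is needed where `α x = 1`, since `J^0` evaluates at `t`. -/
theorem isRLDeriv_of_ae_eq_rlIntegral (ha₀ : 0 < a₀) (hαm : Measurable α)
    (hα : ∀ x, α x ∈ Icc a₀ 1) (hw : ContinuousOn w (Icc 0 T))
    (hg : ContinuousOn g (Icc 0 T)) {G : ℝ → X → ℝ} (hG : IsJointVersion T g G)
    (h : ∀ t ∈ Icc 0 T, ∀ᵐ x ∂μ, w t x = rlIntegral (α x) (fun s => G s x) t) :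
    IsRLDeriv T α w g := by
  obtain ⟨W, hW⟩ := exists_isJointVersion hw
  obtain ⟨M, -, hM⟩ := exists_norm_le_of_continuousOn hg
  refine ⟨fun t => ∫ s in (0 : ℝ)..t, g s, ⟨W, hW, fun t ht => ?_⟩,
    fun t ht => hasDerivWithinAt_integral hg ht⟩
  have hWG : ∀ t ∈ Icc 0 T, ∀ᵐ x ∂μ, W t x = rlIntegral (α x) (fun s => G s x) t :=
    fun t ht => by
      filter_upwards [h t ht, hW.2 t ht] with x hx hx'
      rw [hx', hx]
  have hmeas : MeasurableSet {z : ℝ × X | W z.1 z.2 = rlIntegral (α z.2) (fun s => G s z.2) z.1} :=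
    measurableSet_eq_fun hW.1 (measurable_rlIntegral hαm (fun x => ha₀.le.trans (hα x).1) hG.1)
  have hGt := hG.mono ht.2
  filter_upwards [ae_ae_restrict_of_forall_ae hmeas hWG, hWG t ht, hG.ae_integrableOn hM,
    hGt.coeFn_integral (hg.mono (Icc_subset_Icc_right ht.2)) ht.1] with x hx hxt hGx hint
  rw [hint]
  have := rlIntegral_eq_of_ae_eq_rlIntegral (f := fun s => W s x)
    ⟨ha₀.trans_le (hα x).1, (hα x).2⟩ ht.1 (hGx.mono_set (Ioc_subset_Ioc_right ht.2)) hxt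
    (ae_restrict_Ioc_mono ht.2 hx)
  exact ⟨this.1, this.2.symm⟩

theorem isSolution_iff_satisfiesIntegralEq (hT : 0 < T) (ha₀ : 0 < a₀) (hαm : Measurable α)
    (hα : ∀ x, α x ∈ Icc a₀ 1) (A : Lp ℝ p μ →L[ℝ] Lp ℝ p μ) (u₀ : Lp ℝ p μ)
    {φ : ℝ → Lp ℝ p μ} (hφ : ContinuousOn φ (Icc 0 T)) :
    IsSolution T α A u₀ φ ↔ SatisfiesIntegralEq T α A u₀ φ := by
  have hα0 : ∀ x, 0 < α x := fun x => ha₀.trans_le (hα x).1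
  have hA : ContinuousOn (fun t => A (φ t)) (Icc 0 T) := A.continuous.comp_continuousOn hφ
  have hw : ContinuousOn (fun t => φ t - φ 0) (Icc 0 T) := hφ.sub continuousOn_const
  constructor
  · intro h
    obtain ⟨G, hG⟩ := exists_isJointVersion hA
    refine ⟨G, hG, fun t ht => ?_⟩
    filter_upwards [hG.ae_intervalIntegrable_rpow hA ha₀ hαm hα ht,
      IsRLDeriv.ae_eq_rlIntegral hT ha₀ hαm hα hw (sub_self _) hA h.caputo hG t ht,
      Lp.coeFn_sub (φ t) (φ 0)] with x hi hx hsub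
    refine ⟨hi, ?_⟩
    rw [← rlIntegral_of_ne_zero (hα0 x).ne', ← hx, hsub, ← h.initial, Pi.sub_apply]
    ring
  · rintro ⟨G, hG, h⟩
    -- At `t = 0` the integral term vanishes, so the integral equation contains the initial
    -- condition.
    have h0 : φ 0 = u₀ := by
      refine Lp.ext ?_
      filter_upwards [h 0 (left_mem_Icc.2 hT.le)] with x hx
      simpa using hx.2
    refine ⟨isRLDeriv_of_ae_eq_rlIntegral ha₀ hαm hα hw hA hG fun t ht => ?_, h0⟩
    filter_upwards [h t ht, Lp.coeFn_sub (φ t) (φ 0)] with x hx hsub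
    rw [rlIntegral_of_ne_zero (hα0 x).ne', hsub, h0, Pi.sub_apply, hx.2]
    ring

end

/-! ### Reduction to an everywhere bounded measurable order -/

theorem isSolution_congr {T : ℝ} {α α' : X → ℝ} (hα : α =ᵐ[μ] α')
    {A : Lp ℝ p μ →L[ℝ] Lp ℝ p μ} {u₀ : Lp ℝ p μ} {φ : ℝ → Lp ℝ p μ}
    (h : IsSolution T α A u₀ φ) : IsSolution T α' A u₀ φ := by
  obtain ⟨⟨v, ⟨F, hF, hFv⟩, hv⟩, h0⟩ := h
  refine ⟨⟨v, ⟨F, hF, fun t ht => ?_⟩, hv⟩, h0⟩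
  filter_upwards [hα, hFv t ht] with x hx h
  rwa [← hx]

theorem satisfiesIntegralEq_congr {T : ℝ} {α α' : X → ℝ} (hα : α =ᵐ[μ] α')
    {A : Lp ℝ p μ →L[ℝ] Lp ℝ p μ} {u₀ : Lp ℝ p μ} {φ : ℝ → Lp ℝ p μ}
    (h : SatisfiesIntegralEq T α A u₀ φ) : SatisfiesIntegralEq T α' A u₀ φ := by
  obtain ⟨F, hF, h⟩ := h
  refine ⟨F, hF, fun t ht => ?_⟩
  filter_upwards [hα, h t ht] with x hx h
  rwa [← hx]

/-- Clamping a measurable representative to `[a, b]` changes it only on a null set. -/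
theorem exists_measurable_ae_eq_mem_Icc {α : X → ℝ} (hα : AEMeasurable α μ) {a b : ℝ}
    (hab : a ≤ b) (h : ∀ᵐ x ∂μ, α x ∈ Icc a b) :
    ∃ α' : X → ℝ, Measurable α' ∧ (∀ x, α' x ∈ Icc a b) ∧ α =ᵐ[μ] α' := by
  refine ⟨fun x => projIcc a b hab (hα.mk α x),
    (continuous_subtype_val.comp continuous_projIcc).measurable.comp hα.measurable_mk,
    fun x => (projIcc a b hab _).2, ?_⟩
  filter_upwards [h, hα.ae_eq_mk] with x hx hmk
  rw [← hmk, projIcc_of_mem hab hx]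

end

end VariableOrder

theorem proposition3p1 {n : ℕ} (Ω : Set (EuclideanSpace ℝ (Fin n))) (hΩ : IsOpen Ω)
    (p : ℝ≥0∞) [Fact (1 ≤ p)]
    (A : Lp ℝ p (volume.restrict Ω) →L[ℝ] Lp ℝ p (volume.restrict Ω))
    (α : EuclideanSpace ℝ (Fin n) → ℝ) (hα : MemLp α ∞ (volume.restrict Ω))
    (α₀ : ℝ) (hα₀ : α₀ ∈ Ioo (0 : ℝ) 1) (hαI : ∀ᵐ x ∂(volume.restrict Ω), α x ∈ Icc α₀ 1)
    (u₀ : Lp ℝ p (volume.restrict Ω))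
    (T : ℝ) (hT : 0 < T)
    (φ : ℝ → Lp ℝ p (volume.restrict Ω)) (hφ : ContinuousOn φ (Icc 0 T)) :
    VariableOrder.IsSolution T α A u₀ φ ↔ VariableOrder.SatisfiesIntegralEq T α A u₀ φ := by
  obtain ⟨α', hαm, hα', hαα'⟩ := VariableOrder.exists_measurable_ae_eq_mem_Icc
    hα.1.aemeasurable hα₀.2.le hαI
  have key := VariableOrder.isSolution_iff_satisfiesIntegralEq hT hα₀.1 hαm hα' A u₀ hφ
  exact ⟨fun h => VariableOrder.satisfiesIntegralEq_congr hαα'.symm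
      (key.1 (VariableOrder.isSolution_congr hαα' h)),
    fun h => VariableOrder.isSolution_congr hαα'.symm
      (key.2 (VariableOrder.satisfiesIntegralEq_congr hαα' h))⟩
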